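/- **Definitions.** A skew lattice is a set with associative idempotent operations $\wedge,\vee$ satisfying $x\wedge(x\vee y)=x=x\vee(x\wedge y)$ and $(y\vee x)\wedge x=x=(y\wedge x)\vee x$; its natural order is $y\le x$ iff $x\wedge y=y\wedge x=y$. A *left-handed skew Boolean algebra* is an algebra $(S;\wedge,\vee,\setminus,0)$ such that $(S;\wedge,\vee)$ is a skew lattice with $x\wedge y\wedge x=x\wedge y$ and $x\vee y\vee x=y\vee x$, which is symmetric ($x\wedge y=y\wedge x$ iff $x\vee y=y\vee x$), $x\wedge 0=0\wedge x=0$ for all $x$, each $\lceil x\rceil=\{y: y\le x\}$ is a Boolean lattice, and $x\setminus y$ is the complement of $x\wedge y\wedge x$ in $\lceil x\rceil$. Write $x\,\mathcal D\,y$ iff $x\wedge y\wedge x=x$ and $y\wedge x\wedge y=y$; this is a congruence. A homomorphism $\varphi:S\to T$ is *proper* if every element of $T/\mathcal D$ lies below $[\varphi(s)]_{\mathcal D}$ for some $s\in S$. Let $\mathsf{Skew}$ be the category of left-handed skew Boolean algebras and proper homomorphisms. Let $\mathsf{BS}$ be the category of Boolean spaces (Hausdorff spaces in which the compact-open sets form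 a base) and continuous maps under which inverse images of compact sets are compact. Fix an integer $n\ge 0$. Let $\mathbf{n+2}=\{0,1,\dots,n+1\}$ be the left-handed skew Boolean algebra with zero $0$ in which $x\wedge y=x$, $x\vee y=y$ and $x\setminus y=0$ for nonzero $x,y$. For a Boolean space $X$ let $\lambda_n(X)$ be the set of continuous maps $f:X\to\{0,\dots,n+1\}$ (discrete) with $f^{-1}(1),\dots,f^{-1}(n+1)$ compact, with the pointwise operations of $\mathbf{n+2}$; for a morphism $g$ put $\lambda_n(g)(f)=f\circ g$. For $S$ in $\mathsf{Skew}$ let $\Lambda_n(S)$ be the set of all morphisms $S\to\mathbf{n+2}$ in $\mathsf{Skew}$, with the subspace topology from the product $\{0,\dots,n+1\}^S$; for a morphism $h$ put $\Lambda_n(h)(f)=f\circ h$. The functor $\Lambda_n:\mathsf{Skew}\to\mathsf{BS}^{op}$ is left adjoint to $\lambda_n:\mathsf{BS}^{op}\to\mathsf{Skew}$, with unit $\eta_S(a)(g)=g(a)$ and counit $\epsilon_X:X\to\Lambda_n\lambda_n(X)$ (a morphism of $\mathsf{BS}$), $\epsilon_X(x)(f)=f(x)$. Let $T=\lambda_n\Lambda_n$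 be the induced monad on $\mathsf{Skew}$, with unit $\eta$ and multiplication $\mu_S=\lambda_n(\epsilon_{\Lambda_n(S)})$. A pair $(S,\gamma)$ with $\gamma:T(S)\to S$ a morphism of $\mathsf{Skew}$ is a $T$-algebra if $\gamma\circ\eta_S=1_S$ and $\gamma\circ\mu_S=\gamma\circ T(\gamma)$; a morphism of $T$-algebras $(S_1,\gamma_1)\to(S_2,\gamma_2)$ is a morphism $h:S_1\to S_2$ of $\mathsf{Skew}$ with $\gamma_2\circ T(h)=h\circ\gamma_1$. **Theorem.** Let $n\ge 0$. 1. Let $S$ be a left-handed skew Boolean algebra and $\gamma:T(S)\to S$ a morphism of $\mathsf{Skew}$. Then $(S,\gamma)$ is a $T$-algebra if and only if, up to isomorphism, $S=\lambda_n(X)$ and $\gamma=\lambda_n(\epsilon_X)$ for some Boolean space $X$; that is, there are a Boolean space $X$ and an isomorphism $\varphi:\lambda_n(X)\to S$ in $\mathsf{Skew}$ with $\gamma\circ T(\varphi)=\varphi\circ\lambda_n(\epsilon_X)$. 2. Let $X_1,X_2$ be Boolean spaces. A map $h:\lambda_n(X_1)\to\lambda_n(X_2)$ is a morphism of $T$-algebras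 $(\lambda_n(X_1),\lambda_n(\epsilon_{X_1}))\to(\lambda_n(X_2),\lambda_n(\epsilon_{X_2}))$ if and only if $h=\lambda_n(f)$ for some morphism $f:X_2\to X_1$ of Boolean spaces. -/

import Mathlib

open CategoryTheory Opposite

universe u v

set_option linter.unusedVariables false

/-! ## Left-handed skew Boolean algebras -/

/-- A left-handed skew Boolean algebra `(S; ∧, ∨, \, 0)`. -/
class LHSkewBoolAlg (S : Type u) where
  meet : S → S → S
  join : S → S → S
  diff : S → S → S
  zero : S
  -- skew lattice
  meet_assoc : ∀ x y z, meet (meet x y) z = meet x (meet y z)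
  join_assoc : ∀ x y z, join (join x y) z = join x (join y z)
  meet_idem : ∀ x, meet x x = x
  join_idem : ∀ x, join x x = x
  meet_join_absorb : ∀ x y, meet x (join x y) = x
  join_meet_absorb : ∀ x y, join x (meet x y) = x
  join_absorb_meet : ∀ x y, meet (join y x) x = x
  meet_absorb_join : ∀ x y, join (meet y x) x = x
  -- left-handed
  meet_left : ∀ x y, meet (meet x y) x = meet x y
  join_left : ∀ x y, join (join x y) x = join y x
  -- symmetric
  symmetric : ∀ x y, meet x y = meet y x ↔ join x y = join y x
  -- zero
  meet_zero : ∀ x, meet x zero = zero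
  zero_meet : ∀ x, meet zero x = zero
  -- each `⌈x⌉ = {y | y ≤ x}` is a Boolean lattice: it is commutative, distributive, and
  -- complemented; the complement of `y = x ∧ y ∧ x` is `x \ y` (see the next axioms)
  meet_comm_below : ∀ x y z, (meet x y = y ∧ meet y x = y) → (meet x z = z ∧ meet z x = z) →
    meet y z = meet z y
  join_comm_below : ∀ x y z, (meet x y = y ∧ meet y x = y) → (meet x z = z ∧ meet z x = z) →
    join y z = join z y
  distrib_below : ∀ x a b c, (meet x a = a ∧ meet a x = a) → (meet x b = b ∧ meet b x = b) →
    (meet x c = c ∧ meet c x = c) → meet a (join b c) = join (meet a b) (meet a c)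
  -- `x \ y` is the complement of `x ∧ y ∧ x` in `⌈x⌉`
  diff_le : ∀ x y, meet x (diff x y) = diff x y ∧ meet (diff x y) x = diff x y
  meet_diff : ∀ x y, meet (meet (meet x y) x) (diff x y) = zero
  join_diff : ∀ x y, join (meet (meet x y) x) (diff x y) = x

namespace LHSkewBoolAlg

infixl:70 " ⋏ " => LHSkewBoolAlg.meet
infixl:65 " ⋎ " => LHSkewBoolAlg.join

/-- The equivalence relation `𝓓`. -/
def DRel {S : Type u} [LHSkewBoolAlg S] (x y : S) : Prop :=
  x ⋏ y ⋏ x = x ∧ y ⋏ x ⋏ y = y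

/-- The order of `S/𝓓` on representatives: `[x] ≤ [y]`, that is `[x] ∧ [y] = [x]` in `S/𝓓`. -/
def DLe {S : Type u} [LHSkewBoolAlg S] (x y : S) : Prop := DRel (x ⋏ y) x

theorem dLe_iff {S : Type u} [LHSkewBoolAlg S] (x y : S) : DLe x y ↔ x ⋏ y = x := by
  constructor
  · rintro ⟨-, h⟩
    rwa [← meet_assoc x x y, meet_idem, meet_left] at h
  · intro h
    rw [DLe, h]
    exact ⟨by rw [meet_idem, meet_idem], by rw [meet_idem, meet_idem]⟩

end LHSkewBoolAlg

open LHSkewBoolAlg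

/-- Proper homomorphisms of left-handed skew Boolean algebras. Properness: the induced map
`S/𝓓 → T/𝓓` is such that every element of `T/𝓓` lies below an element of its image. -/
@[ext]
structure SkewHom (S : Type u) (T : Type v) [LHSkewBoolAlg S] [LHSkewBoolAlg T] where
  toFun : S → T
  map_meet : ∀ x y, toFun (x ⋏ y) = toFun x ⋏ toFun y
  map_join : ∀ x y, toFun (x ⋎ y) = toFun x ⋎ toFun y
  map_diff : ∀ x y, toFun (diff x y) = diff (toFun x) (toFun y)
  map_zero : toFun zero = zero
  proper : ∀ t : T, ∃ s : S, DLe t (toFun s)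

/-- Composition of proper homomorphisms. -/
def SkewHom.comp {R S : Type u} {T : Type v} [LHSkewBoolAlg R] [LHSkewBoolAlg S]
    [LHSkewBoolAlg T] (g : SkewHom S T) (f : SkewHom R S) : SkewHom R T where
  toFun r := g.toFun (f.toFun r)
  map_meet x y := by rw [f.map_meet, g.map_meet]
  map_join x y := by rw [f.map_join, g.map_join]
  map_diff x y := by rw [f.map_diff, g.map_diff]
  map_zero := by rw [f.map_zero, g.map_zero]
  proper t := by
    obtain ⟨w, hw⟩ := g.proper t
    obtain ⟨s, hs⟩ := f.proper w
    rw [dLe_iff] at hw hs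
    refine ⟨s, (dLe_iff _ _).2 ?_⟩
    rw [← hw, meet_assoc, ← g.map_meet, hs]

/-- The category `Skew` of left-handed skew Boolean algebras and proper homomorphisms. -/
structure SkewCat where
  carrier : Type u
  [str : LHSkewBoolAlg carrier]

attribute [instance] SkewCat.str

instance : Category SkewCat.{u} where
  Hom S T := SkewHom S.carrier T.carrier
  id S :=
    { toFun := fun s => s
      map_meet := fun _ _ => rfl
      map_join := fun _ _ => rfl
      map_diff := fun _ _ => rfl
      map_zero := rfl
      proper := fun t => ⟨t, by rw [dLe_iff, meet_idem]⟩ }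
  comp f g := SkewHom.comp g f

/-! ## Boolean spaces -/

/-- The category `BS` of (locally compact) Boolean spaces: Hausdorff spaces in which the
compact-open sets form a base of the topology. -/
structure BoolSpace where
  carrier : Type u
  [top : TopologicalSpace carrier]
  [t2 : T2Space carrier]
  [base : PrespectralSpace carrier]

attribute [instance] BoolSpace.top BoolSpace.t2 BoolSpace.base

/-- Continuous proper maps (inverse images of compact sets are compact). -/
@[ext]
structure BoolSpaceHom (X : Type u) (Y : Type u) [TopologicalSpace X] [TopologicalSpace Y] where
  toFun : X → Y
  continuous : Continuous toFun
  proper : ∀ K : Set Y, IsCompact K → IsCompact (toFun ⁻¹' K)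

instance : Category BoolSpace.{u} where
  Hom X Y := BoolSpaceHom X.carrier Y.carrier
  id X := { toFun := fun x => x, continuous := continuous_id, proper := fun _ hK => hK }
  comp f g :=
    { toFun := fun x => g.toFun (f.toFun x)
      continuous := g.continuous.comp f.continuous
      proper := fun K hK => f.proper _ (g.proper K hK) }

/-! ## The primitive algebra `n+2` -/

/-- The primitive left-handed skew Boolean algebra on `{0, 1, …, n+1}`: for nonzero `x, y`
one has `x ∧ y = x`, `x ∨ y = y` and `x \ y = 0`. -/
instance primitiveSkew (n : ℕ) : LHSkewBoolAlg (Fin (n + 2)) where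
  meet x y := if y = 0 then 0 else x
  join x y := if y = 0 then x else y
  diff x y := if y = 0 then x else 0
  zero := 0
  meet_assoc x y z := by grind
  join_assoc x y z := by grind
  meet_idem x := by grind
  join_idem x := by grind
  meet_join_absorb x y := by grind
  join_meet_absorb x y := by grind
  join_absorb_meet x y := by grind
  meet_absorb_join x y := by grind
  meet_left x y := by grind
  join_left x y := by grind
  symmetric x y := by grind
  meet_zero x := by grind
  zero_meet x := by grind
  meet_comm_below x y z := by grind
  join_comm_below x y z := by grind
  distrib_below x a b c := by grind
  diff_le x y := by grind
  meet_diff x y := by grind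
  join_diff x y := by grind

/-! ## The functor `λ_n` -/

/-- The elements of `λ_n(X)`: continuous maps `f : X → {0, …, n+1}` (discrete) such that
`f⁻¹(1), …, f⁻¹(n+1)` are compact. -/
@[ext]
structure LamElt (n : ℕ) (X : Type u) [TopologicalSpace X] where
  toFun : X → Fin (n + 2)
  continuous : Continuous toFun
  compact : ∀ i : Fin (n + 2), i ≠ 0 → IsCompact (toFun ⁻¹' {i})

theorem LamElt.supp_compact {n : ℕ} {X : Type u} [TopologicalSpace X] (f : LamElt n X) :
    IsCompact {x | f.toFun x ≠ 0} := by
  have h : {x | f.toFun x ≠ 0} = ⋃ i ∈ {i : Fin (n + 2) | i ≠ 0}, f.toFun ⁻¹' {i} := by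
    ext x; simp
  rw [h]
  exact (Set.toFinite _).isCompact_biUnion fun i hi => f.compact i hi

theorem LamElt.compact_of_supp {n : ℕ} {X : Type u} [TopologicalSpace X] (f : X → Fin (n + 2))
    (hf : Continuous f) (K : Set X) (hK : IsCompact K) (h : ∀ x, f x ≠ 0 → x ∈ K)
    (i : Fin (n + 2)) (hi : i ≠ 0) : IsCompact (f ⁻¹' {i}) := by
  refine hK.of_isClosed_subset (isClosed_singleton.preimage hf) fun x hx => h x ?_
  have hx' : f x = i := hx
  rwa [hx']

/-- A binary operation on `{0, …, n+1}` fixing `(0, 0)`, applied pointwise in `λ_n(X)`. -/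
def LamElt.map₂ {n : ℕ} {X : Type u} [TopologicalSpace X]
    (op : Fin (n + 2) → Fin (n + 2) → Fin (n + 2)) (h0 : op 0 0 = 0) (f g : LamElt n X) :
    LamElt n X where
  toFun x := op (f.toFun x) (g.toFun x)
  continuous :=
    (continuous_of_discreteTopology (f := fun p : Fin (n + 2) × Fin (n + 2) => op p.1 p.2)).comp
      (f.continuous.prodMk g.continuous)
  compact := by
    refine LamElt.compact_of_supp _ ((continuous_of_discreteTopology
      (f := fun p : Fin (n + 2) × Fin (n + 2) => op p.1 p.2)).comp
      (f.continuous.prodMk g.continuous)) _ (f.supp_compact.union g.supp_compact) fun x hx => ?_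
    by_contra hc
    simp only [Set.mem_union, Set.mem_ofPred_eq, not_or, not_not] at hc
    exact hx (by simp [hc.1, hc.2, h0])

theorem LamElt.le_apply {n : ℕ} {X : Type u} [TopologicalSpace X] {x y a b : LamElt n X}
    (h : LamElt.map₂ meet (meet_idem 0) x y = a ∧ LamElt.map₂ meet (meet_idem 0) y x = b) (p : X) :
    x.toFun p ⋏ y.toFun p = a.toFun p ∧ y.toFun p ⋏ x.toFun p = b.toFun p :=
  ⟨by rw [← h.1]; rfl, by rw [← h.2]; rfl⟩

/-- `λ_n(X)` with the operations induced pointwise by those of `n+2`. -/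
instance LamElt.instSkew (n : ℕ) (X : Type u) [TopologicalSpace X] :
    LHSkewBoolAlg (LamElt n X) where
  meet := LamElt.map₂ meet (meet_idem 0)
  join := LamElt.map₂ join (join_idem 0)
  diff := LamElt.map₂ diff rfl
  zero :=
    { toFun := fun _ => 0
      continuous := continuous_const
      compact := LamElt.compact_of_supp _ continuous_const ∅ isCompact_empty
        fun _ h => (h rfl).elim }
  meet_assoc x y z := LamElt.ext (funext fun _ => meet_assoc _ _ _)
  join_assoc x y z := LamElt.ext (funext fun _ => join_assoc _ _ _)
  meet_idem x := LamElt.ext (funext fun _ => meet_idem _)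
  join_idem x := LamElt.ext (funext fun _ => join_idem _)
  meet_join_absorb x y := LamElt.ext (funext fun _ => meet_join_absorb _ _)
  join_meet_absorb x y := LamElt.ext (funext fun _ => join_meet_absorb _ _)
  join_absorb_meet x y := LamElt.ext (funext fun _ => join_absorb_meet _ _)
  meet_absorb_join x y := LamElt.ext (funext fun _ => meet_absorb_join _ _)
  meet_left x y := LamElt.ext (funext fun _ => meet_left _ _)
  join_left x y := LamElt.ext (funext fun _ => join_left _ _)
  symmetric x y :=
    ⟨fun h => LamElt.ext (funext fun p =>
        (symmetric _ _).1 (congrFun (congrArg LamElt.toFun h) p)),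
      fun h => LamElt.ext (funext fun p =>
        (symmetric _ _).2 (congrFun (congrArg LamElt.toFun h) p))⟩
  meet_zero x := LamElt.ext (funext fun _ => meet_zero _)
  zero_meet x := LamElt.ext (funext fun _ => zero_meet _)
  meet_comm_below x y z hy hz := LamElt.ext (funext fun p =>
    meet_comm_below _ _ _ (le_apply hy p) (le_apply hz p))
  join_comm_below x y z hy hz := LamElt.ext (funext fun p =>
    join_comm_below _ _ _ (le_apply hy p) (le_apply hz p))
  distrib_below x a b c ha hb hc := LamElt.ext (funext fun p =>
    distrib_below _ _ _ _ (le_apply ha p) (le_apply hb p) (le_apply hc p))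
  diff_le x y := ⟨LamElt.ext (funext fun _ => (diff_le _ _).1),
    LamElt.ext (funext fun _ => (diff_le _ _).2)⟩
  meet_diff x y := LamElt.ext (funext fun _ => meet_diff _ _)
  join_diff x y := LamElt.ext (funext fun _ => join_diff _ _)

theorem primitiveSkew_dLe_iff {n : ℕ} (i j : Fin (n + 2)) : DLe i j ↔ (i ≠ 0 → j ≠ 0) := by
  rw [dLe_iff]
  change (if j = 0 then 0 else i) = i ↔ _
  grind

theorem LamElt.dLe_iff {n : ℕ} {X : Type u} [TopologicalSpace X] (f g : LamElt n X) :
    DLe f g ↔ ∀ x, f.toFun x ≠ 0 → g.toFun x ≠ 0 := by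
  rw [LHSkewBoolAlg.dLe_iff, LamElt.ext_iff, funext_iff]
  refine forall_congr' fun x => ?_
  rw [← primitiveSkew_dLe_iff, LHSkewBoolAlg.dLe_iff]
  rfl

theorem exists_compactOpen_superset {X : Type u} [TopologicalSpace X] [PrespectralSpace X]
    {K : Set X} (hK : IsCompact K) : ∃ U, IsOpen U ∧ IsCompact U ∧ K ⊆ U := by
  refine hK.induction_on ⟨∅, isOpen_empty, isCompact_empty, subset_rfl⟩
    (fun s t hst ⟨U, h1, h2, h3⟩ => ⟨U, h1, h2, hst.trans h3⟩)
    (fun s t ⟨U, h1, h2, h3⟩ ⟨V, k1, k2, k3⟩ =>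
      ⟨U ∪ V, h1.union k1, h2.union k2, Set.union_subset_union h3 k3⟩) fun x _ => ?_
  obtain ⟨U, ⟨hU, hc⟩, hx, -⟩ :=
    (PrespectralSpace.isTopologicalBasis (X := X)).exists_subset_of_mem_open
      (Set.mem_univ x) isOpen_univ
  exact ⟨U, mem_nhdsWithin_of_mem_nhds (hU.mem_nhds hx), U, hU, hc, subset_rfl⟩

/-- Every compact subset of a Boolean space lies in the support of some element of `λ_n(X)`. -/
theorem LamElt.exists_supp {n : ℕ} {X : Type u} [TopologicalSpace X] [T2Space X]
    [PrespectralSpace X] {K : Set X} (hK : IsCompact K) :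
    ∃ f : LamElt n X, ∀ x ∈ K, f.toFun x ≠ 0 := by
  classical
  obtain ⟨U, ho, hc, hKU⟩ := exists_compactOpen_superset hK
  have hcont : Continuous fun x => if x ∈ U then (1 : Fin (n + 2)) else 0 := by
    refine IsLocallyConstant.continuous ((IsLocallyConstant.iff_exists_open _).2 fun x => ?_)
    by_cases hx : x ∈ U
    · exact ⟨U, ho, hx, fun y hy => by simp [hx, hy]⟩
    · exact ⟨Uᶜ, hc.isClosed.isOpen_compl, hx, fun y hy => by
        have hy' : y ∉ U := hy
        simp [hx, hy']⟩
  refine ⟨⟨_, hcont, LamElt.compact_of_supp _ hcont U hc fun x hx => ?_⟩, fun x hx => ?_⟩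
  · by_contra h
    simp [h] at hx
  · simp [hKU hx]

/-- `λ_n(g)(f) = f ∘ g` -/
def lamMap (n : ℕ) {X Y : BoolSpace.{u}} (g : X ⟶ Y) :
    SkewHom (LamElt n Y.carrier) (LamElt n X.carrier) where
  toFun f :=
    { toFun := fun x => f.toFun (BoolSpaceHom.toFun g x)
      continuous := f.continuous.comp (BoolSpaceHom.continuous g)
      compact := fun i hi => BoolSpaceHom.proper g _ (f.compact i hi) }
  map_meet _ _ := rfl
  map_join _ _ := rfl
  map_diff _ _ := rfl
  map_zero := rfl
  proper f := by
    obtain ⟨k, hk⟩ := LamElt.exists_supp (n := n)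
      (f.supp_compact.image (BoolSpaceHom.continuous g))
    exact ⟨k, (LamElt.dLe_iff _ _).2 fun x hx => hk _ ⟨x, hx, rfl⟩⟩

/-- The functor `λ_n : BSᵒᵖ ⥤ Skew`. -/
def lamFunctor (n : ℕ) : BoolSpace.{u}ᵒᵖ ⥤ SkewCat.{u} where
  obj X := ⟨LamElt n X.unop.carrier⟩
  map g := lamMap n g.unop
  map_id _ := rfl
  map_comp _ _ := rfl

/-! ## The functor `Λ_n` -/

/-- `Λ_n(S)`: the set of all morphisms `S → n+2` in `Skew`. -/
abbrev BigLam (n : ℕ) (S : Type u) [LHSkewBoolAlg S] : Type u := SkewHom S (Fin (n + 2))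

/-- The subspace topology inherited from the product space `{0, …, n+1}^S`. -/
instance BigLam.instTopologicalSpace (n : ℕ) (S : Type u) [LHSkewBoolAlg S] :
    TopologicalSpace (BigLam n S) :=
  TopologicalSpace.induced (fun f => f.toFun) inferInstance

theorem BigLam.isInducing (n : ℕ) (S : Type u) [LHSkewBoolAlg S] :
    Topology.IsInducing (fun f : BigLam n S => f.toFun) := ⟨rfl⟩

theorem BigLam.continuous_eval {n : ℕ} {S : Type u} [LHSkewBoolAlg S] (s : S) :
    Continuous fun f : BigLam n S => f.toFun s :=
  (continuous_apply s).comp (BigLam.isInducing n S).continuous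

/-- A morphism to `n+2` is proper if and only if it is nonzero. -/
theorem BigLam.exists_ne_zero {n : ℕ} {S : Type u} [LHSkewBoolAlg S] (f : BigLam n S) :
    ∃ s, f.toFun s ≠ 0 := by
  obtain ⟨s, hs⟩ := f.proper 1
  exact ⟨s, (primitiveSkew_dLe_iff _ _).1 hs (by simp)⟩

theorem BigLam.isCompact_fiber {n : ℕ} {S : Type u} [LHSkewBoolAlg S] (s : S) (i : Fin (n + 2))
    (hi : i ≠ 0) : IsCompact ((fun f : BigLam n S => f.toFun s) ⁻¹' {i}) := by
  rw [(BigLam.isInducing n S).isCompact_iff]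
  have h : (fun f : BigLam n S => f.toFun) '' ((fun f : BigLam n S => f.toFun s) ⁻¹' {i}) =
      {φ : S → Fin (n + 2) | (∀ x y, φ (x ⋏ y) = φ x ⋏ φ y) ∧ (∀ x y, φ (x ⋎ y) = φ x ⋎ φ y) ∧
        (∀ x y, φ (diff x y) = diff (φ x) (φ y)) ∧ φ zero = zero ∧ φ s = i} := by
    ext φ
    constructor
    · rintro ⟨f, hf, rfl⟩
      exact ⟨f.map_meet, f.map_join, f.map_diff, f.map_zero, hf⟩
    · rintro ⟨h1, h2, h3, h4, h5⟩
      refine ⟨⟨φ, h1, h2, h3, h4, fun t => ⟨s, (primitiveSkew_dLe_iff _ _).2 fun _ => ?_⟩⟩, h5, rfl⟩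
      rwa [h5]
  have hop : ∀ (op : Fin (n + 2) → Fin (n + 2) → Fin (n + 2)) (x y z : S),
      IsClosed {φ : S → Fin (n + 2) | φ z = op (φ x) (φ y)} := fun op x y z =>
    isClosed_eq (continuous_apply z)
      (Continuous.comp (g := fun p : Fin (n + 2) × Fin (n + 2) => op p.1 p.2)
        (f := fun φ : S → Fin (n + 2) => (φ x, φ y)) continuous_of_discreteTopology
        ((continuous_apply x).prodMk (continuous_apply y)))
  rw [h]
  refine IsClosed.isCompact ?_
  simp only [Set.ofPred_and, Set.ofPred_forall]
  refine IsClosed.inter (isClosed_iInter fun x => isClosed_iInter fun y => hop _ _ _ _) <|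
    IsClosed.inter (isClosed_iInter fun x => isClosed_iInter fun y => hop _ _ _ _) <|
    IsClosed.inter (isClosed_iInter fun x => isClosed_iInter fun y => hop _ _ _ _) <|
    IsClosed.inter (isClosed_eq (continuous_apply _) continuous_const)
      (isClosed_eq (continuous_apply _) continuous_const)

instance BigLam.instT2Space (n : ℕ) (S : Type u) [LHSkewBoolAlg S] : T2Space (BigLam n S) :=
  T2Space.of_injective_continuous (f := fun f : BigLam n S => f.toFun)
    (fun _ _ h => SkewHom.ext h) (BigLam.isInducing n S).continuous

instance BigLam.instPrespectralSpace (n : ℕ) (S : Type u) [LHSkewBoolAlg S] :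
    PrespectralSpace (BigLam n S) where
  isTopologicalBasis := by
    refine TopologicalSpace.isTopologicalBasis_of_isOpen_of_nhds (fun U hU => hU.1)
      fun f U hf hU => ?_
    obtain ⟨V, hV, rfl⟩ := (BigLam.isInducing n S).isOpen_iff.1 hU
    obtain ⟨I, w, hw, hIV⟩ := isOpen_pi_iff.1 hV f.toFun hf
    obtain ⟨s, hs⟩ := f.exists_ne_zero
    let A : Set (BigLam n S) := ⋂ t ∈ I, (fun g : BigLam n S => g.toFun t) ⁻¹' {f.toFun t}
    let B : Set (BigLam n S) := (fun g : BigLam n S => g.toFun s) ⁻¹' {f.toFun s}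
    refine ⟨A ∩ B, ⟨IsOpen.inter ?_ ?_, ?_⟩, ⟨?_, rfl⟩, ?_⟩
    · exact isOpen_biInter_finset fun t _ =>
        (isOpen_discrete _).preimage (BigLam.continuous_eval t)
    · exact (isOpen_discrete _).preimage (BigLam.continuous_eval s)
    · exact (BigLam.isCompact_fiber s _ hs).inter_left (isClosed_biInter fun t _ =>
        (isClosed_discrete _).preimage (BigLam.continuous_eval t))
    · simp [A]
    · rintro g ⟨hg, -⟩
      refine hIV fun t ht => ?_
      have h1 : g.toFun t = f.toFun t := by
        have := Set.mem_iInter₂.1 hg t ht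
        exact this
      change g.toFun t ∈ w t
      rw [h1]
      exact (hw t ht).2

theorem BigLam.exists_bound {n : ℕ} {S : Type u} [LHSkewBoolAlg S] {K : Set (BigLam n S)}
    (hK : IsCompact K) : ∃ s : S, ∀ f ∈ K, f.toFun s ≠ 0 := by
  refine hK.induction_on ⟨zero, fun _ h => h.elim⟩
    (fun _ _ hst ⟨a, ha⟩ => ⟨a, fun f hf => ha f (hst hf)⟩)
    (fun A B ⟨a, ha⟩ ⟨b, hb⟩ => ⟨a ⋎ b, fun f hf => ?_⟩) fun f _ => ?_
  · rw [f.map_join]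
    change (if f.toFun b = 0 then f.toFun a else f.toFun b) ≠ 0
    rcases hf with hf | hf
    · have := ha f hf
      grind
    · have := hb f hf
      grind
  · obtain ⟨s, hs⟩ := f.exists_ne_zero
    exact ⟨{g | g.toFun s ≠ 0}, mem_nhdsWithin_of_mem_nhds
      (((isOpen_discrete {0}ᶜ).preimage (BigLam.continuous_eval s)).mem_nhds hs),
      s, fun g hg => hg⟩

/-- A map into `Λ_n(S)` is continuous and proper if all of its evaluations lie in `λ_n(X)`. -/
def BigLam.homOfEval {n : ℕ} {S : Type u} [LHSkewBoolAlg S] {X : Type u} [TopologicalSpace X]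
    (e : X → BigLam n S) (hc : ∀ s, Continuous fun x => (e x).toFun s)
    (hp : ∀ s (i : Fin (n + 2)), i ≠ 0 → IsCompact ((fun x => (e x).toFun s) ⁻¹' {i})) :
    BoolSpaceHom X (BigLam n S) where
  toFun := e
  continuous := (BigLam.isInducing n S).continuous_iff.2 (continuous_pi hc)
  proper K hK := by
    have hcont : Continuous e := (BigLam.isInducing n S).continuous_iff.2 (continuous_pi hc)
    obtain ⟨s, hs⟩ := BigLam.exists_bound hK
    exact (LamElt.supp_compact ⟨_, hc s, hp s⟩).of_isClosed_subset
      (hK.isClosed.preimage hcont) fun x hx => hs _ hx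

/-- `Λ_n(S)` as a Boolean space. -/
def bigLamSpace (n : ℕ) (S : SkewCat.{u}) : BoolSpace.{u} := ⟨BigLam n S.carrier⟩

/-- `Λ_n(h)(f) = f ∘ h` -/
def bigLamMap (n : ℕ) {S T : SkewCat.{u}} (h : S ⟶ T) : bigLamSpace n T ⟶ bigLamSpace n S :=
  BigLam.homOfEval (fun f : BigLam n T.carrier => SkewHom.comp f h)
    (fun s => BigLam.continuous_eval (SkewHom.toFun h s))
    (fun s i hi => BigLam.isCompact_fiber (SkewHom.toFun h s) i hi)

/-- The functor `Λ_n : Skew ⥤ BSᵒᵖ`. -/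
def bigLamFunctor (n : ℕ) : SkewCat.{u} ⥤ BoolSpace.{u}ᵒᵖ where
  obj S := op (bigLamSpace n S)
  map h := (bigLamMap n h).op
  map_id _ := rfl
  map_comp _ _ := rfl

/-! ## The adjunction `Λ_n ⊣ λ_n` and its monad -/

/-- The unit `η_S : S ⟶ λ_n Λ_n(S)`, `η_S(a)(g) = g(a)`. -/
def etaHom (n : ℕ) (S : SkewCat.{u}) : S ⟶ (lamFunctor n).obj ((bigLamFunctor n).obj S) where
  toFun a :=
    { toFun := fun g : BigLam n S.carrier => g.toFun a
      continuous := BigLam.continuous_eval a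
      compact := fun i hi => BigLam.isCompact_fiber a i hi }
  map_meet a b := LamElt.ext (funext fun g : BigLam n S.carrier => g.map_meet a b)
  map_join a b := LamElt.ext (funext fun g : BigLam n S.carrier => g.map_join a b)
  map_diff a b := LamElt.ext (funext fun g : BigLam n S.carrier => g.map_diff a b)
  map_zero := LamElt.ext (funext fun g : BigLam n S.carrier => g.map_zero)
  proper t := by
    obtain ⟨s, hs⟩ := BigLam.exists_bound (LamElt.supp_compact t)
    exact ⟨s, (LamElt.dLe_iff _ _).2 hs⟩

/-- The counit `ε_X : X ⟶ Λ_n λ_n(X)`, `ε_X(x)(f) = f(x)`. -/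
def epsHom (n : ℕ) (X : BoolSpace.{u}) : X ⟶ bigLamSpace n ((lamFunctor n).obj (op X)) :=
  BigLam.homOfEval
    (fun x : X.carrier =>
      ({ toFun := fun f => f.toFun x
         map_meet := fun _ _ => rfl
         map_join := fun _ _ => rfl
         map_diff := fun _ _ => rfl
         map_zero := rfl
         proper := fun t => by
          obtain ⟨f, hf⟩ := LamElt.exists_supp (n := n) (isCompact_singleton (x := x))
          exact ⟨f, (primitiveSkew_dLe_iff _ _).2 fun _ => hf x rfl⟩ } :
        BigLam n (LamElt n X.carrier)))
    (fun f => LamElt.continuous f) (fun f => LamElt.compact f)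

/-- The adjunction `Λ_n ⊣ λ_n` with unit `η` and counit `ε`. -/
def lamAdjunction (n : ℕ) : bigLamFunctor.{u} n ⊣ lamFunctor.{u} n :=
  Adjunction.mkOfUnitCounit
    { unit := { app := fun S => etaHom n S, naturality := fun _ _ _ => rfl }
      counit := { app := fun X => (epsHom n X.unop).op, naturality := fun _ _ _ => rfl }
      left_triangle := rfl
      right_triangle := rfl }

/-- The monad `T = λ_n Λ_n` on `Skew` induced by the adjunction: its unit is `η`, and its
multiplication is `μ = λ_n ε Λ_n`. -/
def lamMonad (n : ℕ) : Monad SkewCat.{u} := (lamAdjunction n).toMonad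

/-- `(S, γ)` is an algebra for the monad `T`. -/
def IsMonadAlgebra {C : Type*} [Category* C] (T : Monad C) (S : C) (γ : T.obj S ⟶ S) : Prop :=
  T.η.app S ≫ γ = 𝟙 S ∧ T.μ.app S ≫ γ = T.map γ ≫ γ

/-- `h` is a morphism `(S₁, γ₁) ⟶ (S₂, γ₂)` of algebras for the monad `T`. -/
def IsMonadAlgebraHom {C : Type*} [Category* C] (T : Monad C) {S₁ S₂ : C} (γ₁ : T.obj S₁ ⟶ S₁)
    (γ₂ : T.obj S₂ ⟶ S₂) (h : S₁ ⟶ S₂) : Prop :=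
  T.map h ≫ γ₂ = γ₁ ≫ h

/-- The morphism `λ_n ε_X : T(λ_n(X)) ⟶ λ_n(X)`. -/
def lamStructure (n : ℕ) (X : BoolSpace.{u}) :
    (lamMonad n).obj ((lamFunctor n).obj (op X)) ⟶ (lamFunctor n).obj (op X) :=
  (lamFunctor n).map (epsHom n X).op

/-!
The theorem says that `λ_n : BSᵒᵖ ⥤ Skew` is monadic. Everything rests on one topological fact,
`LamElt.exists_extension`: an element of `λ_n(W)` that is constant on the fibres of a proper map
`e : W → Z` into a Boolean space extends along `e` to an element of `λ_n(Z)`. This holds because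
disjoint compact and closed sets in a Boolean space are separated by a compact-open set.

*Objects.* Given an algebra `(S, γ)`, let `X ⊆ Λ_n(S)` be the equalizer of `Λ_n(γ)` and
`ε_{Λ_n(S)}`, that is, the closed set of all `g` with `g(γ(F)) = F(g)` for all `F ∈ T(S)`. The
restriction map `T(S) → λ_n(X)` is onto by the extension property. If `F` and `G` agree on `X`,
then `γ(F) = γ(G)` (`IsMonadAlgebra.eq_of_algebraRestrict_eq`): `Λ_n(γ)` and `ε_{Λ_n(S)}` have the
common retraction `Λ_n(η_S)`, so a coincidence of their values happens only at one and the same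
point of `X`; hence some `H` satisfies `H ∘ Λ_n(γ) = F` and `H ∘ ε = G`, and the associativity law
evaluated at `H` is the claim. As evaluation `S → λ_n(X)` composed with `γ` is restriction, it is
bijective, and it respects the structure maps by the definition of `X`.

*Morphisms.* The counit `ε_X` is a closed embedding, and a point of `Λ_nλ_n(X)` outside its image
is separated from the image by an element of `λ_nΛ_nλ_n(X)` (`mem_range_epsHom`). If `k` is a
morphism of algebras, then `Λ_n(k) ∘ ε_{X₂}` is not separated in this way from the image of
`ε_{X₁}`, so it factors through `ε_{X₁}`, and the factor `f` satisfies `k = λ_n(f)`.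
-/

/-! ### Extension along proper maps -/

theorem BoolSpaceHom.isProperMap {X Y : Type u} [TopologicalSpace X] [TopologicalSpace Y]
    [T2Space Y] [PrespectralSpace Y] (g : BoolSpaceHom X Y) : IsProperMap g.toFun :=
  isProperMap_iff_isCompact_preimage.2 ⟨g.continuous, fun {K} hK => g.proper K hK⟩

theorem IsProperMap.sumElim {X Y Z : Type*} [TopologicalSpace X] [TopologicalSpace Y]
    [TopologicalSpace Z] [T2Space Z] [PrespectralSpace Z] {f : X → Z} {g : Y → Z}
    (hf : IsProperMap f) (hg : IsProperMap g) : IsProperMap (Sum.elim f g) := by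
  refine isProperMap_iff_isCompact_preimage.2
    ⟨hf.continuous.sumElim hg.continuous, fun {K} hK => ?_⟩
  rw [Set.preimage_sumElim]
  exact ((hf.isCompact_preimage hK).image continuous_inl).union
    ((hg.isCompact_preimage hK).image continuous_inr)

/-- The element of `λ_n(X ⊔ Y)` given by an element of `λ_n(X)` and an element of `λ_n(Y)`. -/
def LamElt.sumElim {n : ℕ} {X : Type u} {Y : Type v} [TopologicalSpace X] [TopologicalSpace Y]
    (f : LamElt n X) (g : LamElt n Y) : LamElt n (X ⊕ Y) where
  toFun := Sum.elim f.toFun g.toFun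
  continuous := f.continuous.sumElim g.continuous
  compact i hi := by
    rw [Set.preimage_sumElim]
    exact ((f.compact i hi).image continuous_inl).union ((g.compact i hi).image continuous_inr)

/-- Every function on a discrete compact space belongs to `λ_n`. -/
def LamElt.ofDiscrete {n : ℕ} {X : Type u} [TopologicalSpace X] [DiscreteTopology X]
    [CompactSpace X] (f : X → Fin (n + 2)) : LamElt n X where
  toFun := f
  continuous := continuous_of_discreteTopology
  compact _ _ := (isClosed_discrete _).isCompact

/-- Extension along a proper map: an element of `λ_n(W)` which is constant on the fibres of a
proper map `e : W → Z` into a Boolean space factors through `e`. -/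
theorem LamElt.exists_extension {n : ℕ} {W : Type u} {Z : Type v} [TopologicalSpace W]
    [TopologicalSpace Z] [T2Space Z] [PrespectralSpace Z] {e : W → Z} (he : IsProperMap e)
    (f : LamElt n W) (hf : ∀ w w', e w = e w' → f.toFun w = f.toFun w') :
    ∃ H : LamElt n Z, ∀ w, H.toFun (e w) = f.toFun w := by
  classical
  -- For `i ≠ 0`, a compact-open set `V i` meets the image of `e` exactly in `e '' f⁻¹(i)`.
  have hV : ∀ i : Fin (n + 2), ∃ V : Set Z, IsOpen V ∧ IsCompact V ∧
      (i ≠ 0 → ∀ w, e w ∈ V ↔ f.toFun w = i) := by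
    intro i
    -- The index `0` gets a dummy value; no condition is imposed on it.
    by_cases hi : i = 0
    · exact ⟨∅, isOpen_empty, isCompact_empty, fun h => (h hi).elim⟩
    have hclosed : IsClosed (e '' (f.toFun ⁻¹' {i}ᶜ)) :=
      he.isClosedMap _ ((isClosed_discrete _).preimage f.continuous)
    obtain ⟨V, hVc, hVo, h1, h2⟩ := PrespectralSpace.exists_isCompact_and_isOpen_between
      ((f.compact i hi).image he.continuous) hclosed.isOpen_compl (by
        rintro _ ⟨w, hw, rfl⟩ ⟨w', hw', h⟩
        exact hw' ((hf _ _ h).trans hw))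
    refine ⟨V, hVo, hVc, fun _ w => ⟨fun hw => ?_, fun hw => h1 ⟨w, hw, rfl⟩⟩⟩
    by_contra hne
    exact h2 hw ⟨w, hne, rfl⟩
  choose V hVo hVc hV using hV
  let g : Fin (n + 2) → Z → Fin (n + 2) := fun i z => if z ∈ V i then i else 0
  have hg : ∀ i, Continuous (g i) := fun i => by
    refine continuous_const.if (fun z hz => ?_) continuous_const
    have hclopen : IsClopen {z | z ∈ V i} := ⟨(hVc i).isClosed, hVo i⟩
    rw [hclopen.frontier_eq] at hz
    exact hz.elim
  have hcont : Continuous fun z => Finset.univ.sup fun i => g i z :=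
    Continuous.finset_sup_apply fun i _ => hg i
  refine ⟨⟨_, hcont, LamElt.compact_of_supp _ hcont (⋃ i, V i) (isCompact_iUnion hVc)
    fun z hz => ?_⟩, fun w => ?_⟩
  · by_contra hc
    simp only [Set.mem_iUnion, not_exists] at hc
    exact hz (by simp [g, hc])
  · change (Finset.univ.sup fun i => g i (e w)) = f.toFun w
    refine le_antisymm (Finset.sup_le fun i _ => ?_) ?_
    · by_cases hi : i = 0
      · simp [g, hi]
      · by_cases hw : e w ∈ V i
        · simp [g, hw, (hV i hi w).1 hw]
        · simp [g, hw]
    · by_cases hi : f.toFun w = 0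
      · simp [hi]
      · have h := (hV _ hi w).2 rfl
        calc f.toFun w = g (f.toFun w) (e w) := by simp [g, h]
          _ ≤ _ := Finset.le_sup (f := fun i => g i (e w)) (Finset.mem_univ _)

/-! ### The image of the counit -/

theorem epsHom_injective (n : ℕ) (X : BoolSpace.{u}) :
    Function.Injective (BoolSpaceHom.toFun (epsHom n X)) := by
  intro x y hxy
  by_contra hne
  obtain ⟨H, hH⟩ := LamElt.exists_extension (e := fun b : Bool => cond b x y)
    (continuous_of_discreteTopology.isProperMap)
    (LamElt.ofDiscrete (n := n) fun b => cond b 1 0) (by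
      rintro (_ | _) (_ | _) h <;> simp_all [eq_comm])
  have h1 : H.toFun x = H.toFun y := congrFun (congrArg SkewHom.toFun hxy) H
  have h2 : H.toFun x = 1 := hH true
  have h3 : H.toFun y = 0 := hH false
  rw [h2, h3] at h1
  exact one_ne_zero h1

theorem epsHom_isClosedEmbedding (n : ℕ) (X : BoolSpace.{u}) :
    Topology.IsClosedEmbedding (BoolSpaceHom.toFun (epsHom n X)) :=
  .of_continuous_injective_isClosedMap (BoolSpaceHom.continuous _) (epsHom_injective n X)
    (BoolSpaceHom.isProperMap _).isClosedMap

/-- A point of `Λ_n λ_n(X)` is an evaluation as soon as it does not separate any element of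
`λ_n Λ_n λ_n(X)` vanishing on the evaluations from zero. -/
theorem mem_range_epsHom {n : ℕ} {X : BoolSpace.{u}}
    (p : BigLam n (LamElt n X.carrier))
    (hp : ∀ H : LamElt n (BigLam n (LamElt n X.carrier)),
      (∀ x, H.toFun (BoolSpaceHom.toFun (epsHom n X) x) = 0) → H.toFun p = 0) :
    ∃ x, BoolSpaceHom.toFun (epsHom n X) x = p := by
  by_contra! hne
  obtain ⟨H, hH⟩ := LamElt.exists_extension
    (e := Sum.elim (BoolSpaceHom.toFun (epsHom n X)) fun _ : Unit => p)
    ((BoolSpaceHom.isProperMap _).sumElim continuous_const.isProperMap)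
    (LamElt.sumElim (zero : LamElt n X.carrier) (LamElt.ofDiscrete fun _ => 1)) (by
      rintro (x | _) (y | _) h
      · rfl
      · exact (hne x h).elim
      · exact (hne y h.symm).elim
      · rfl)
  have h1 := hp H fun x => hH (.inl x)
  have h2 : H.toFun p = 1 := hH (.inr ())
  rw [h2] at h1
  exact one_ne_zero h1

/-! ### Morphisms of algebras -/

/-- By `mem_range_epsHom`, each point evaluation composed with a morphism of algebras is again a
point evaluation; the resulting map of points is continuous and proper because `ε` is a closed
embedding. -/
theorem exists_eq_lamMap_of_isMonadAlgebraHom {n : ℕ} {X₁ X₂ : BoolSpace.{u}}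
    (k : (lamFunctor n).obj (op X₁) ⟶ (lamFunctor n).obj (op X₂))
    (hk : IsMonadAlgebraHom (lamMonad n) (lamStructure n X₁) (lamStructure n X₂) k) :
    ∃ f : X₂ ⟶ X₁, k = (lamFunctor n).map f.op := by
  let p : X₂ ⟶ bigLamSpace n ((lamFunctor n).obj (op X₁)) := epsHom n X₂ ≫ bigLamMap n k
  have hcomp : ∀ (H : LamElt n (BigLam n (LamElt n X₁.carrier))) (x : X₂.carrier),
      H.toFun (BoolSpaceHom.toFun p x) =
        (SkewHom.toFun k ((SkewHom.toFun (lamStructure n X₁) H : LamElt n X₁.carrier)) :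
          LamElt n X₂.carrier).toFun x :=
    fun H x => congrFun (congrArg LamElt.toFun (congrFun (congrArg SkewHom.toFun hk) H)) x
  have hmem : ∀ x, ∃ y, BoolSpaceHom.toFun (epsHom n X₁) y = BoolSpaceHom.toFun p x := by
    intro x
    refine mem_range_epsHom _ fun H hH => ?_
    have h0 : (SkewHom.toFun (lamStructure n X₁) H : LamElt n X₁.carrier) =
        (zero : LamElt n X₁.carrier) := LamElt.ext (funext hH)
    rw [hcomp, h0]
    exact congrFun (congrArg LamElt.toFun (SkewHom.map_zero k)) x
  choose f hf using hmem
  have hε := epsHom_isClosedEmbedding n X₁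
  have hfun : BoolSpaceHom.toFun (epsHom n X₁) ∘ f = BoolSpaceHom.toFun p := funext hf
  refine ⟨(⟨f, hε.isInducing.continuous_iff.2 ?_, fun K hK => ?_⟩ :
    BoolSpaceHom X₂.carrier X₁.carrier), ?_⟩
  · rw [hfun]
    exact BoolSpaceHom.continuous p
  · rw [← hε.injective.preimage_image K, ← Set.preimage_comp, hfun]
    exact BoolSpaceHom.proper p _ (hK.image hε.continuous)
  · refine SkewHom.ext (funext fun a => LamElt.ext (funext fun x => ?_))
    exact (congrFun (congrArg SkewHom.toFun (hf x)) a).symm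

theorem lamMap_isMonadAlgebraHom {n : ℕ} {X₁ X₂ : BoolSpace.{u}} (f : X₂ ⟶ X₁) :
    IsMonadAlgebraHom (lamMonad n) (lamStructure n X₁) (lamStructure n X₂)
      ((lamFunctor n).map f.op) := rfl

/-! ### The space of an algebra -/

variable {n : ℕ} {S : SkewCat.{u}} (γ : (lamMonad n).obj S ⟶ S)

/-- The space of an algebra `(S, γ)`: the subspace of those `g ∈ Λ_n(S)` with `g(γ(F)) = F(g)`
for all `F`, which is the equalizer of `Λ_n(γ)` and `ε_{Λ_n(S)}`. -/
abbrev AlgebraPoint : Type u :=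
  {g : BigLam n S.carrier // ∀ F : LamElt n (BigLam n S.carrier),
    g.toFun (SkewHom.toFun γ F) = F.toFun g}

theorem isClosedEmbedding_algebraPoint_val :
    Topology.IsClosedEmbedding (Subtype.val : AlgebraPoint γ → BigLam n S.carrier) := by
  refine IsClosed.isClosedEmbedding_subtypeVal ?_
  change IsClosed {g : BigLam n S.carrier | ∀ F : LamElt n (BigLam n S.carrier),
    g.toFun (SkewHom.toFun γ F) = F.toFun g}
  simp only [Set.ofPred_forall]
  exact isClosed_iInter fun F => isClosed_eq (BigLam.continuous_eval _) F.continuous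

/-- The space of an algebra, as a Boolean space. -/
def algebraSpace : BoolSpace.{u} where
  carrier := AlgebraPoint γ
  base := .of_isClosedEmbedding _ (isClosedEmbedding_algebraPoint_val γ)

/-- The inclusion of the space of `(S, γ)` into `Λ_n(S)`. -/
def algebraSpaceIncl : algebraSpace γ ⟶ bigLamSpace n S :=
  (⟨Subtype.val, (isClosedEmbedding_algebraPoint_val γ).continuous, fun _ hK =>
    (isClosedEmbedding_algebraPoint_val γ).isCompact_preimage hK⟩ :
    BoolSpaceHom (AlgebraPoint γ) (BigLam n S.carrier))

/-- Restriction of an element of `T(S)` to the space of `(S, γ)`. -/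
def algebraRestrict : (lamMonad n).obj S ⟶ (lamFunctor n).obj (op (algebraSpace γ)) :=
  (lamFunctor n).map (algebraSpaceIncl γ).op

theorem algebraRestrict_surjective : Function.Surjective (SkewHom.toFun (algebraRestrict γ)) := by
  intro f
  obtain ⟨H, hH⟩ := LamElt.exists_extension
    (isClosedEmbedding_algebraPoint_val γ).isProperMap f
    fun w w' h => by rw [Subtype.val_injective h]
  exact ⟨H, LamElt.ext (funext hH)⟩

variable {γ}

/-- Two elements of `T(S)` which agree on the space of an algebra `(S, γ)` have the same image
under `γ`. Both `Λ_n(γ)` and `ε_{Λ_n(S)}` are sections of `Λ_n(η_S)`, so their images meet only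
over the space of the algebra. -/
theorem IsMonadAlgebra.eq_of_algebraRestrict_eq (hγ : IsMonadAlgebra (lamMonad n) S γ)
    {F G : LamElt n (BigLam n S.carrier)}
    (h : SkewHom.toFun (algebraRestrict γ) F = SkewHom.toFun (algebraRestrict γ) G) :
    SkewHom.toFun γ F = SkewHom.toFun γ G := by
  have hunit : ∀ s : S.carrier, SkewHom.toFun γ (SkewHom.toFun (etaHom n S) s) = s := fun s =>
    congrFun (congrArg SkewHom.toFun hγ.1) s
  let a : bigLamSpace n S ⟶ bigLamSpace n ((lamMonad n).obj S) := bigLamMap n γ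
  let b : bigLamSpace n S ⟶ bigLamSpace n ((lamMonad n).obj S) := epsHom n (bigLamSpace n S)
  -- `a` and `b` have the common retraction `Λ_n(η_S)`.
  let r : BigLam n ((lamMonad n).obj S).carrier → BigLam n S.carrier :=
    BoolSpaceHom.toFun (bigLamMap n (etaHom n S))
  have ha : ∀ g, r (BoolSpaceHom.toFun a g) = g := fun g =>
    SkewHom.ext (funext fun s => congrArg (SkewHom.toFun g) (hunit s))
  have hb : ∀ g, r (BoolSpaceHom.toFun b g) = g := fun g => rfl
  have hab : ∀ g g', BoolSpaceHom.toFun a g = BoolSpaceHom.toFun b g' →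
      F.toFun g = G.toFun g' := by
    intro g g' hgg
    obtain rfl : g = g' := by rw [← ha g, hgg, hb]
    exact congrFun (congrArg LamElt.toFun h)
      (⟨g, fun K => congrFun (congrArg SkewHom.toFun hgg) K⟩ : AlgebraPoint γ)
  obtain ⟨H, hH⟩ := LamElt.exists_extension
    ((BoolSpaceHom.isProperMap a).sumElim (BoolSpaceHom.isProperMap b)) (LamElt.sumElim F G) (by
      rintro (g | g) (g' | g') hgg
      · change F.toFun g = F.toFun g'
        rw [← ha g, ← ha g']
        exact congrArg _ (congrArg r hgg)
      · exact hab g g' hgg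
      · exact (hab g' g hgg.symm).symm
      · change G.toFun g = G.toFun g'
        rw [← hb g, ← hb g']
        exact congrArg _ (congrArg r hgg))
  have hF : SkewHom.toFun ((lamMonad n).map γ) H = F :=
    LamElt.ext (funext fun g => hH (.inl g))
  have hG : SkewHom.toFun ((lamMonad n).μ.app S) H = G :=
    LamElt.ext (funext fun g => hH (.inr g))
  have := congrFun (congrArg SkewHom.toFun hγ.2) H
  calc SkewHom.toFun γ F = SkewHom.toFun γ (SkewHom.toFun ((lamMonad n).map γ) H) := by rw [hF]
    _ = SkewHom.toFun γ (SkewHom.toFun ((lamMonad n).μ.app S) H) := this.symm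
    _ = SkewHom.toFun γ G := by rw [hG]

variable (γ) in
/-- The map `S → λ_n(X)`, where `X` is the space of `(S, γ)`, sending `s` to evaluation at `s`. -/
def algebraEval : S ⟶ (lamFunctor n).obj (op (algebraSpace γ)) := etaHom n S ≫ algebraRestrict γ

/-- This is the defining condition on the points of the space of `(S, γ)`. -/
theorem comp_algebraEval : γ ≫ algebraEval γ = algebraRestrict γ :=
  SkewHom.ext (funext fun F => LamElt.ext (funext fun g => g.2 F))

theorem IsMonadAlgebra.algebraEval_injective (hγ : IsMonadAlgebra (lamMonad n) S γ) :
    Function.Injective (SkewHom.toFun (algebraEval γ)) := by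
  intro s t h
  have hunit : ∀ s : S.carrier, SkewHom.toFun γ (SkewHom.toFun (etaHom n S) s) = s := fun s =>
    congrFun (congrArg SkewHom.toFun hγ.1) s
  rw [← hunit s, ← hunit t]
  exact hγ.eq_of_algebraRestrict_eq h

variable (γ) in
theorem algebraEval_surjective : Function.Surjective (SkewHom.toFun (algebraEval γ)) := by
  intro f
  obtain ⟨F, hF⟩ := algebraRestrict_surjective γ f
  refine ⟨SkewHom.toFun γ F, ?_⟩
  rw [← hF, ← comp_algebraEval]
  rfl

/-! ### Isomorphisms and transport of structure -/

/-- A bijective morphism of `Skew` is an isomorphism. -/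
noncomputable def SkewCat.isoOfBijective {S T : SkewCat.{u}} (f : S ⟶ T)
    (hf : Function.Bijective (SkewHom.toFun f)) : S ≅ T where
  hom := f
  inv :=
    let e := Equiv.ofBijective _ hf
    have he : ∀ s, SkewHom.toFun f (e.symm s) = s := e.apply_symm_apply
    { toFun := e.symm
      map_meet x y := hf.1 (by rw [SkewHom.map_meet, he, he, he])
      map_join x y := hf.1 (by rw [SkewHom.map_join, he, he, he])
      map_diff x y := hf.1 (by rw [SkewHom.map_diff, he, he, he])
      map_zero := hf.1 (by rw [SkewHom.map_zero, he])
      proper s := ⟨SkewHom.toFun f s, by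
        rw [show e.symm (SkewHom.toFun f s) = s from e.symm_apply_apply s, dLe_iff, meet_idem]⟩ }
  hom_inv_id := SkewHom.ext (funext fun s => (Equiv.ofBijective _ hf).symm_apply_apply s)
  inv_hom_id := SkewHom.ext (funext fun s => (Equiv.ofBijective _ hf).apply_symm_apply s)

variable (γ) in
/-- Both composites send `F ∈ T(S)` to its restriction to the space of `(S, γ)`. -/
theorem isMonadAlgebraHom_algebraEval :
    IsMonadAlgebraHom (lamMonad n) γ (lamStructure n (algebraSpace γ)) (algebraEval γ) := by
  rw [IsMonadAlgebraHom, comp_algebraEval]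
  rfl

theorem lamStructure_isMonadAlgebra (n : ℕ) (X : BoolSpace.{u}) :
    IsMonadAlgebra (lamMonad n) ((lamFunctor n).obj (op X)) (lamStructure n X) :=
  ⟨rfl, rfl⟩

/-- The axioms of an algebra transport along isomorphisms compatible with the structure maps. -/
theorem IsMonadAlgebra.of_iso {C : Type*} [Category* C] {T : Monad C} {A B : C} {α : T.obj A ⟶ A}
    {β : T.obj B ⟶ B} (hα : IsMonadAlgebra T A α) (φ : A ≅ B)
    (hφ : IsMonadAlgebraHom T α β φ.hom) : IsMonadAlgebra T B β := by
  have hφ' : T.map φ.hom ≫ β = α ≫ φ.hom := hφ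
  have hβ : β = T.map φ.inv ≫ α ≫ φ.hom := by
    rw [← hφ', ← Category.assoc, ← T.map_comp, φ.inv_hom_id, T.map_id, Category.id_comp]
  constructor
  · have := T.η.naturality_assoc φ.inv (α ≫ φ.hom)
    rw [hβ, ← this, reassoc_of% hα.1]
    simp
  · have := T.μ.naturality_assoc φ.inv (α ≫ φ.hom)
    rw [hβ]
    simp only [Functor.map_comp, Category.assoc]
    rw [← Functor.comp_map, ← this, reassoc_of% hα.2]
    simp only [← Functor.map_comp_assoc]
    simp

/-! ### Monadicity of `λ_n` -/

theorem mainTheorem4 (n : ℕ) :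
    (∀ (S : SkewCat.{u}) (γ : (lamMonad n).obj S ⟶ S),
      IsMonadAlgebra (lamMonad n) S γ ↔
        ∃ (X : BoolSpace.{u}) (φ : (lamFunctor n).obj (op X) ≅ S),
          (lamMonad n).map φ.hom ≫ γ = lamStructure n X ≫ φ.hom) ∧
    (∀ (X₁ X₂ : BoolSpace.{u}) (h : LamElt n X₁.carrier → LamElt n X₂.carrier),
      (∃ k : (lamFunctor n).obj (op X₁) ⟶ (lamFunctor n).obj (op X₂),
        IsMonadAlgebraHom (lamMonad n) (lamStructure n X₁) (lamStructure n X₂) k ∧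
          SkewHom.toFun k = h) ↔
        ∃ f : X₂ ⟶ X₁, h = SkewHom.toFun ((lamFunctor n).map f.op)) := by
  refine ⟨fun S γ => ⟨fun hγ => ?_, ?_⟩, fun X₁ X₂ h => ⟨?_, ?_⟩⟩
  · let ψ : S ≅ (lamFunctor n).obj (op (algebraSpace γ)) := SkewCat.isoOfBijective (algebraEval γ)
      ⟨hγ.algebraEval_injective, algebraEval_surjective γ⟩
    have hψ : (lamMonad n).map ψ.hom ≫ lamStructure n _ = γ ≫ ψ.hom :=
      isMonadAlgebraHom_algebraEval γ
    refine ⟨algebraSpace γ, ψ.symm, ?_⟩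
    rw [Iso.symm_hom, ← cancel_mono ψ.hom, Category.assoc, Category.assoc, ← hψ, ψ.inv_hom_id,
      ← Functor.map_comp_assoc, ψ.inv_hom_id]
    simp
  · rintro ⟨X, φ, hφ⟩
    exact (lamStructure_isMonadAlgebra n X).of_iso φ hφ
  · rintro ⟨k, hk, rfl⟩
    obtain ⟨f, rfl⟩ := exists_eq_lamMap_of_isMonadAlgebraHom k hk
    exact ⟨f, rfl⟩
  · rintro ⟨f, rfl⟩
    exact ⟨_, lamMap_isMonadAlgebraHom f, rfl⟩
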